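/- For each integer $N\ge 1$ consider a dataset consisting of four groups of $N$ samples each, one group for every combination of validity $v\in\{\text{valid},\text{invalid}\}$ and plausibility $p\in\{\text{plausible},\text{implausible}\}$. A classifier predicts the validity of every sample. Let $C_{v,p}$ be the number of samples of group $(v,p)$ whose validity is predicted correctly, let $A_{v,p}=100\,C_{v,p}/N$ be the measured accuracy of that group in percent, and, writing $\mathrm v,\neg \mathrm v$ for valid/invalid and $\mathrm p,\neg \mathrm p$ for plausible/implausible, define the measured content effect $$\mathrm{CE}_N=\tfrac14\bigl(|A_{\mathrm v,\mathrm p}-A_{\mathrm v,\neg \mathrm p}|+|A_{\neg \mathrm v,\mathrm p}-A_{\neg \mathrm v,\neg \mathrm p}|+|A_{\mathrm v,\mathrm p}-A_{\neg \mathrm v,\mathrm p}|+|A_{\mathrm v,\neg \mathrm p}-A_{\neg \mathrm v,\neg \mathrm p}|\bigr).$$ Fix $a\in[0,1]$ and suppose that the classifier is unbiased with accuracy $a$: the samples are classified independently of each other, and each sample, in whichever group, is classified correctly with probability $a$. Then $\mathrm{CE}_N$ is integrable for every $N$, and, as $N\to\infty$, $$\sqrt N\;\mathbb E[\mathrm{CE}_N]\longrightarrow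 200\sqrt{\frac{a(1-a)}{\pi}} \qquad\text{and}\qquad \mathbb E[\mathrm{CE}_N]=(1+o(1))\cdot 200\sqrt{\frac{a(1-a)}{\pi N}} .$$ -/

import Mathlib

open MeasureTheory ProbabilityTheory Filter Topology Asymptotics

/-- The samples of a dataset with `N` samples in each of the four groups. The sample `((v, p), i)` is
the `i`-th one of the group with validity `v` (its true label) and plausibility `p`. -/
abbrev Sample (N : ℕ) : Type := (Bool × Bool) × Fin N

/-- The number `C_g` of samples of the group `g` that are classified correctly, when `y s` is the
label (`true` for "valid") predicted for the sample `s`: the prediction is correct when it is the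
validity of the sample. -/
def correctCount {N : ℕ} (y : Sample N → Bool) (g : Bool × Bool) : ℕ :=
  (Finset.univ.filter fun i : Fin N => y (g, i) = g.1).card

/-- The measured accuracy of the group `g`, in percent. -/
noncomputable def groupAccuracy {N : ℕ} (y : Sample N → Bool) (g : Bool × Bool) : ℝ :=
  100 * (correctCount y g : ℝ) / (N : ℝ)

/-- The average accuracy difference between plausible and implausible samples of equal validity. -/
noncomputable def intraEffect (A : Bool × Bool → ℝ) : ℝ :=
  (|A (true, true) - A (true, false)| + |A (false, true) - A (false, false)|) / 2

/-- The average accuracy difference between valid and invalid samples of equal plausibility. -/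
noncomputable def interEffect (A : Bool × Bool → ℝ) : ℝ :=
  (|A (true, true) - A (false, true)| + |A (true, false) - A (false, false)|) / 2

/-- The content effect for the group accuracies `A (validity, plausibility)`. -/
noncomputable def contentEffect (A : Bool × Bool → ℝ) : ℝ :=
  (intraEffect A + interEffect A) / 2

/-- The content effect measured for the predictions `y`. -/
noncomputable def measuredCE {N : ℕ} (y : Sample N → Bool) : ℝ :=
  contentEffect (groupAccuracy y)

/-- A random family of predictions of an unbiased model with accuracy `a`: the samples are
classified independently, and each of them, in whichever group it lies, receives its correct label
with probability `a`. -/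
structure IsUnbiasedModel {Ω : Type*} [MeasurableSpace Ω] {N : ℕ} (a : ℝ)
    (Y : Sample N → Ω → Bool) (P : Measure Ω) : Prop where
  measurable : ∀ s, Measurable (Y s)
  indep : iIndepFun Y P
  prob_correct : ∀ s, P.real {ω | Y s ω = s.1.1} = a

/-! The content effect is the average of four terms `100 / N * |C_g - C_h|` with `g ≠ h`. By
linearity of expectation the dependence between these terms is irrelevant, and all four have the
same mean. Each `C_g - C_h` is distributed as a sum of `N` iid differences of two independent
Bernoulli variables, centred with variance `2a(1-a)`.

Divided by `√N`, the sum converges in law to a Gaussian `Z` of that variance. Its second moments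
stay bounded, so first absolute moments converge too (`TendstoInDistribution.tendsto_integral_abs`),
with limit `E|Z| = √(2 * 2a(1-a) / π) = 2√(a(1-a)/π)`. The factor 100 then gives the constant 200.
-/

theorem integral_abs_gaussianReal (v : NNReal) :
    ∫ x, |x| ∂(gaussianReal 0 v) = √(2 * v / Real.pi) := by
  rcases eq_or_ne v 0 with rfl | hv
  · simp
  have hv' : (0 : ℝ) < v := by positivity
  rw [integral_gaussianReal_eq_integral_smul hv]
  have h1 : ∀ x : ℝ, gaussianPDFReal 0 v x • |x| =
      (fun y : ℝ => (√(2 * Real.pi * v))⁻¹ * (y ^ (1 : ℝ) * Real.exp (-(2 * v : ℝ)⁻¹ * y ^ (2 : ℝ)))) |x| := by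
    intro x
    simp only [gaussianPDFReal, smul_eq_mul, Real.rpow_one, Real.rpow_two, sq_abs, sub_zero]
    rw [show -x ^ 2 / (2 * (v : ℝ)) = -(2 * v : ℝ)⁻¹ * x ^ 2 by field_simp]
    ring
  simp_rw [h1]
  rw [integral_comp_abs (f := fun y : ℝ => (√(2 * Real.pi * v))⁻¹ *
      (y ^ (1 : ℝ) * Real.exp (-(2 * v : ℝ)⁻¹ * y ^ (2 : ℝ)))), integral_const_mul,
    integral_rpow_mul_exp_neg_mul_rpow (by norm_num) (by norm_num) (by positivity)]
  norm_num [Real.rpow_neg_one]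
  have e1 := Real.sq_sqrt hv'.le
  have e2 := Real.sq_sqrt (show (0 : ℝ) ≤ 2 by positivity)
  field_simp
  rw [e1, e2, mul_comm]

/-- A random variable whose second moment is at most `C` is close in mean to its truncation. -/
theorem abs_integral_abs_sub_integral_min_le {Ω : Type*} [MeasurableSpace Ω] {P : Measure Ω}
    [IsProbabilityMeasure P] {X : Ω → ℝ} (hX : MemLp X 2 P) {C : ℝ} (hC : ∫ ω, X ω ^ 2 ∂P ≤ C)
    {K : ℝ} (hK : 0 < K) :
    |∫ ω, |X ω| ∂P - ∫ ω, min |X ω| K ∂P| ≤ C / K := by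
  have hi : Integrable X P := hX.integrable (by norm_num)
  have hm : Integrable (fun ω => min |X ω| K) P := hi.abs.inf (integrable_const K)
  rw [← integral_sub hi.abs hm]
  have h0 : ∀ ω, 0 ≤ |X ω| - min |X ω| K := fun ω => sub_nonneg.2 (min_le_left _ _)
  rw [abs_of_nonneg (integral_nonneg h0)]
  calc ∫ ω, (|X ω| - min |X ω| K) ∂P ≤ ∫ ω, X ω ^ 2 / K ∂P := by
        refine integral_mono (hi.abs.sub hm) (hX.integrable_sq.div_const K) fun ω => ?_
        rw [le_div_iff₀ hK, ← sq_abs (X ω)]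
        rcases le_total |X ω| K with h | h
        · simp only [min_eq_left h, sub_self, zero_mul]; positivity
        · simp only [min_eq_right h]; nlinarith [abs_nonneg (X ω)]
    _ ≤ C / K := by
        rw [integral_div]; gcongr

/-- Convergence in law only controls bounded continuous functions, such as `min |x| K`. The second
moment bound makes the truncation error at most `C / K`, uniformly in the index. -/
theorem MeasureTheory.TendstoInDistribution.tendsto_integral_abs {ι Ω' : Type*} {Ω : ι → Type*}
    [∀ i, MeasurableSpace (Ω i)] [MeasurableSpace Ω'] {P : ∀ i, Measure (Ω i)} {P' : Measure Ω'}
    [∀ i, IsProbabilityMeasure (P i)] [IsProbabilityMeasure P'] {l : Filter ι}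
    {X : ∀ i, Ω i → ℝ} {Z : Ω' → ℝ} (h : TendstoInDistribution X l Z P P') {C : ℝ}
    (hX : ∀ i, MemLp (X i) 2 (P i)) (hXC : ∀ i, ∫ ω, X i ω ^ 2 ∂(P i) ≤ C)
    (hZ : MemLp Z 2 P') (hZC : ∫ ω, Z ω ^ 2 ∂P' ≤ C) :
    Tendsto (fun i => ∫ ω, |X i ω| ∂(P i)) l (𝓝 (∫ ω, |Z ω| ∂P')) := by
  have hC : 0 ≤ C := (integral_nonneg fun ω => sq_nonneg _).trans hZC
  rw [Metric.tendsto_nhds]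
  intro ε hε
  -- Two truncation errors and one convergence error, each at most `ε / 4`, stay below `ε`. The `+
  -- 1` keeps `K` positive when `C = 0`.
  obtain ⟨K, hK, hKε⟩ : ∃ K : ℝ, 0 < K ∧ C / K ≤ ε / 4 :=
    ⟨4 * (C + 1) / ε, by positivity, by
      rw [div_div_eq_mul_div, div_le_iff₀ (by positivity)]; nlinarith⟩
  let f : BoundedContinuousFunction ℝ ℝ := BoundedContinuousFunction.ofNormedAddCommGroup
    (fun x => min |x| K) (by fun_prop) K (fun x => by
      rw [Real.norm_of_nonneg (le_min (abs_nonneg x) hK.le)]; exact min_le_right _ _)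
  have hf := (ProbabilityMeasure.tendsto_iff_forall_integral_tendsto.1 h.tendsto) f
  simp only [ProbabilityMeasure.coe_mk] at hf
  have hfm : ∀ μ : Measure ℝ, AEStronglyMeasurable f μ := fun μ =>
    f.continuous.aestronglyMeasurable
  simp_rw [integral_map (h.forall_aemeasurable _) (hfm _)] at hf
  rw [integral_map h.aemeasurable_limit (hfm _)] at hf
  filter_upwards [Metric.tendsto_nhds.1 hf (ε / 4) (by positivity)] with i hi
  have h1 := abs_integral_abs_sub_integral_min_le (hX i) (hXC i) hK
  have h2 := abs_integral_abs_sub_integral_min_le hZ hZC hK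
  have h3 : |∫ ω, min |X i ω| K ∂(P i) - ∫ ω, min |Z ω| K ∂P'| < ε / 4 := hi
  rw [Real.dist_eq]
  rw [abs_le] at h1 h2
  rw [abs_lt] at h3 ⊢
  constructor <;> linarith

theorem integral_sum_sq_of_iid {Ω : Type*} [MeasurableSpace Ω] {P : Measure Ω}
    [IsProbabilityMeasure P] {X : ℕ → Ω → ℝ} (hX : MemLp (X 0) 2 P) (h0 : P[X 0] = 0)
    (hindep : iIndepFun X P) (hident : ∀ i, IdentDistrib (X i) (X 0) P P) (n : ℕ) :
    ∫ ω, (∑ k ∈ Finset.range n, X k ω) ^ 2 ∂P = n * Var[X 0; P] := by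
  have hm : ∀ i, MemLp (X i) 2 P := fun i => (hident i).memLp_iff.2 hX
  have hs := IndepFun.variance_sum (s := Finset.range n) (fun i _ => hm i)
    (fun i _ j _ hij => hindep.indepFun hij)
  rw [variance_of_integral_eq_zero] at hs
  · simpa [(hident _).variance_eq] using hs
  · exact Finset.aemeasurable_sum _ fun i _ => (hident i).aemeasurable_fst
  · simp only [Finset.sum_apply]
    rw [integral_finsetSum _ fun i _ => (hm i).integrable (by norm_num)]
    simp [(hident _).integral_eq, h0]

/-- The first absolute moment in the central limit theorem. -/
theorem tendsto_integral_abs_sum_of_iid {Ω : Type*} [MeasurableSpace Ω] {P : Measure Ω}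
    [IsProbabilityMeasure P] {X : ℕ → Ω → ℝ} (hX : MemLp (X 0) 2 P) (h0 : P[X 0] = 0)
    (hindep : iIndepFun X P) (hident : ∀ i, IdentDistrib (X i) (X 0) P P) :
    Tendsto (fun n : ℕ => (√n)⁻¹ * ∫ ω, |∑ k ∈ Finset.range n, X k ω| ∂P) atTop
      (𝓝 √(2 * Var[X 0; P] / Real.pi)) := by
  have hv := variance_nonneg (X 0) P
  have h := tendstoInDistribution_inv_sqrt_mul_sum_sub
    (Y := id) (HasLaw.id (μ := gaussianReal 0 Var[X 0; P].toNNReal)) hX hindep hident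
  simp only [h0, mul_zero, sub_zero] at h
  have hm : ∀ i, MemLp (X i) 2 P := fun i => (hident i).memLp_iff.2 hX
  have key := h.tendsto_integral_abs (C := Var[X 0; P])
    (fun n => (memLp_finsetSum _ fun i _ => hm i).const_mul _) (fun n => ?_)
    (memLp_id_gaussianReal 2) ?_
  · simp only [id, integral_abs_gaussianReal, Real.coe_toNNReal _ hv, abs_mul, abs_inv,
      abs_of_nonneg (Real.sqrt_nonneg _), integral_const_mul] at key
    exact key
  · simp only [mul_pow, integral_const_mul]
    rw [integral_sum_sq_of_iid hX h0 hindep hident, inv_pow, Real.sq_sqrt n.cast_nonneg]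
    -- The normalised second moment equals the variance, except at `n = 0`, where `(√0)⁻¹ = 0` makes
    -- it vanish.
    rcases eq_or_ne n 0 with rfl | hn
    · simp [hv]
    · field_simp; exact le_rfl
  · have := variance_id_gaussianReal (μ := 0) (v := Var[X 0; P].toNNReal)
    rw [variance_of_integral_eq_zero (by fun_prop) (by simp)] at this
    simp only [id] at this ⊢
    rw [this, Real.coe_toNNReal _ hv]

/-! ### Differences of independent Bernoulli variables -/

/-- The difference of the indicators of the two entries. -/
def indicatorDiff (u : Bool → Bool) : ℝ := (u true).toNat - (u false).toNat

/-- The law of a sequence of independent pairs of independent Bernoulli variables. -/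
noncomputable def bernoulliPairs (p : unitInterval) : Measure (ℕ → Bool → Bool) :=
  Measure.infinitePi fun _ => Measure.infinitePi fun _ => bernoulliMeasure true false p

instance (p : unitInterval) : IsProbabilityMeasure (bernoulliPairs p) := by
  unfold bernoulliPairs; infer_instance

/-- The mean absolute difference of two independent binomial variables. -/
noncomputable def meanAbsBinomialDiff (p : unitInterval) (n : ℕ) : ℝ :=
  ∫ ω, |∑ k ∈ Finset.range n, indicatorDiff (ω k)| ∂(bernoulliPairs p)

theorem measurable_indicatorDiff : Measurable indicatorDiff := .of_discrete

theorem identDistrib_indicatorDiff (p : unitInterval) (i : ℕ) :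
    IdentDistrib (fun ω : ℕ → Bool → Bool => indicatorDiff (ω i)) (fun ω => indicatorDiff (ω 0))
      (bernoulliPairs p) (bernoulliPairs p) := by
  have h : IdentDistrib (fun ω : ℕ → Bool → Bool => ω i) (fun ω => ω 0)
      (bernoulliPairs p) (bernoulliPairs p) := by
    refine ⟨(measurable_pi_apply i).aemeasurable, (measurable_pi_apply 0).aemeasurable, ?_⟩
    have hi (j : ℕ) := Measure.infinitePi_map_eval
      (fun _ : ℕ => Measure.infinitePi fun _ : Bool => bernoulliMeasure true false p) j
    exact (hi i).trans (hi 0).symm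
  exact h.comp measurable_indicatorDiff

theorem iIndepFun_indicatorDiff (p : unitInterval) :
    iIndepFun (fun (i : ℕ) (ω : ℕ → Bool → Bool) => indicatorDiff (ω i)) (bernoulliPairs p) :=
  iIndepFun_infinitePi (X := fun _ => indicatorDiff) fun _ => measurable_indicatorDiff

theorem memLp_indicatorDiff (p : unitInterval) :
    MemLp (fun ω : ℕ → Bool → Bool => indicatorDiff (ω 0)) 2 (bernoulliPairs p) := by
  refine MemLp.of_bound
    (measurable_indicatorDiff.comp (measurable_pi_apply 0)).aestronglyMeasurable 1
    (ae_of_all _ fun ω => ?_)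
  rw [Real.norm_eq_abs]
  unfold indicatorDiff
  cases ω 0 true <;> cases ω 0 false <;> simp

theorem integral_bernoulliPairs (p : unitInterval) (G : Bool × Bool → ℝ) :
    ∫ ω, G (ω 0 true, ω 0 false) ∂(bernoulliPairs p) =
      p * (p * G (true, true) + (1 - p) * G (true, false)) +
        (1 - p) * (p * G (false, true) + (1 - p) * G (false, false)) := by
  have hmap : (bernoulliPairs p).map (fun ω => (ω 0 true, ω 0 false)) =
      (bernoulliMeasure true false p).prod (bernoulliMeasure true false p) := by
    rw [← Measure.infinitePi_map_eval_prod (P := fun _ : Bool => bernoulliMeasure true false p)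
      (i := true) (j := false) (by simp)]
    rw [← Measure.infinitePi_map_eval (fun _ : ℕ =>
      Measure.infinitePi fun _ : Bool => bernoulliMeasure true false p) 0,
      Measure.map_map (by fun_prop) (by fun_prop)]
    rfl
  rw [← integral_map (f := G) (by fun_prop) Measurable.of_discrete.aestronglyMeasurable, hmap,
    integral_prod _ .of_finite]
  simp [integral_bernoulliMeasure]

theorem integral_indicatorDiff (p : unitInterval) :
    ∫ ω : ℕ → Bool → Bool, indicatorDiff (ω 0) ∂(bernoulliPairs p) = 0 := by
  have := integral_bernoulliPairs p fun u => (u.1.toNat : ℝ) - u.2.toNat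
  refine this.trans ?_
  simp; ring

theorem variance_indicatorDiff (p : unitInterval) :
    Var[fun ω : ℕ → Bool → Bool => indicatorDiff (ω 0); bernoulliPairs p] = 2 * (p * (1 - p)) := by
  rw [variance_of_integral_eq_zero (memLp_indicatorDiff p).aestronglyMeasurable.aemeasurable
    (integral_indicatorDiff p)]
  have := integral_bernoulliPairs p fun u => ((u.1.toNat : ℝ) - u.2.toNat) ^ 2
  refine this.trans ?_
  simp; ring

theorem tendsto_meanAbsBinomialDiff (p : unitInterval) :
    Tendsto (fun n : ℕ => (√n)⁻¹ * meanAbsBinomialDiff p n) atTop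
      (𝓝 (2 * √(p * (1 - p) / Real.pi))) := by
  have h := tendsto_integral_abs_sum_of_iid (memLp_indicatorDiff p) (integral_indicatorDiff p)
    (iIndepFun_indicatorDiff p) (identDistrib_indicatorDiff p)
  rw [variance_indicatorDiff] at h
  convert! h using 2
  rw [show 2 * (2 * ((p : ℝ) * (1 - p))) / Real.pi = 2 ^ 2 * (p * (1 - p) / Real.pi) by ring,
    Real.sqrt_mul (by positivity), Real.sqrt_sq (by norm_num)]

/-- With zero variance the sum has zero second moment, hence vanishes almost surely. -/
theorem meanAbsBinomialDiff_eq_zero {p : unitInterval} (hp : (p : ℝ) * (1 - p) = 0) (n : ℕ) :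
    meanAbsBinomialDiff p n = 0 := by
  have h := integral_sum_sq_of_iid (memLp_indicatorDiff p) (integral_indicatorDiff p)
    (iIndepFun_indicatorDiff p) (identDistrib_indicatorDiff p) n
  rw [variance_indicatorDiff, hp, mul_zero, mul_zero] at h
  have hm : MemLp (fun ω : ℕ → Bool → Bool => ∑ k ∈ Finset.range n, indicatorDiff (ω k)) 2
      (bernoulliPairs p) := memLp_finsetSum _ fun i _ =>
    (identDistrib_indicatorDiff p i).memLp_iff.2 (memLp_indicatorDiff p)
  rw [integral_eq_zero_iff_of_nonneg (fun ω => sq_nonneg _) hm.integrable_sq] at h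
  refine integral_eq_zero_of_ae ?_
  filter_upwards [h] with ω hω
  simpa using hω

/-! ### Reduction of the classifier to the Bernoulli model -/

namespace IsUnbiasedModel

variable {Ω : Type*} [MeasurableSpace Ω] {P : Measure Ω} [IsProbabilityMeasure P] {N : ℕ}
  {p : unitInterval} {Y : Sample N → Ω → Bool}

theorem map_correct (hY : IsUnbiasedModel p Y P) (s : Sample N) :
    P.map (fun ω => Y s ω == s.1.1) = bernoulliMeasure true false p := by
  have hm : Measurable fun ω => Y s ω == s.1.1 :=
    (Measurable.of_discrete (f := fun b : Bool => b == s.1.1)).comp (hY.measurable s)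
  have := Measure.isProbabilityMeasure_map (μ := P) hm.aemeasurable
  have ht : (P.map (fun ω => Y s ω == s.1.1)).real {true} = p := by
    rw [map_measureReal_apply hm (measurableSet_singleton _), ← hY.prob_correct s]
    congr 1; ext ω; simp
  refine ext_iff_measureReal_singleton.2 fun b => ?_
  cases b
  · have hc : ({false} : Set Bool) = {true}ᶜ := by ext b; simp
    rw [hc, probReal_compl_eq_one_sub (measurableSet_singleton _),
      probReal_compl_eq_one_sub (measurableSet_singleton _), ht,
      bernoulliMeasure_real_apply_of_mem_of_notMem _ (measurableSet_singleton _) (by simp)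
        (by simp)]
  · rw [ht, bernoulliMeasure_real_apply_of_mem_of_notMem _ (measurableSet_singleton _) (by simp)
      (by simp)]

/-- Both families are independent with the same Bernoulli marginals, so their joint laws agree. The
condition `g ≠ h` makes the selected samples distinct, so that independence is inherited. -/
theorem identDistrib_correct (hY : IsUnbiasedModel p Y P) {g h : Bool × Bool} (hgh : g ≠ h) :
    IdentDistrib
      (fun ω (q : Fin N × Bool) =>
        Y (if q.2 then g else h, q.1) ω == (if q.2 then g else h).1)
      (fun (ω : ℕ → Bool → Bool) (q : Fin N × Bool) => ω q.1 q.2) P (bernoulliPairs p) := by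
  have hm (s : Sample N) : Measurable fun ω => Y s ω == s.1.1 :=
    (Measurable.of_discrete (f := fun b : Bool => b == s.1.1)).comp (hY.measurable s)
  have hinj : Function.Injective fun q : Fin N × Bool =>
      (((if q.2 then g else h), q.1) : Sample N) := by
    rintro ⟨i, b⟩ ⟨j, c⟩ hq
    have h1 := congrArg Prod.fst hq
    have h2 := congrArg Prod.snd hq
    simp only at h1 h2
    cases b <;> cases c <;> simp_all [eq_comm]
  have hinj' : Function.Injective fun q : Fin N × Bool => ((q.1 : ℕ), q.2) := by
    rintro ⟨i, b⟩ ⟨j, c⟩ hq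
    simpa [Fin.ext_iff] using hq
  refine IdentDistrib.pi (fun q => ⟨(hm _).aemeasurable,
    ((measurable_pi_apply q.2).comp (measurable_pi_apply (q.1 : ℕ))).aemeasurable, ?_⟩) ?_ ?_
  · rw [hY.map_correct]
    have h1 : (bernoulliPairs p).map (fun ω => ω q.1) = _ :=
      Measure.infinitePi_map_eval _ (q.1 : ℕ)
    rw [← Measure.infinitePi_map_eval (fun _ : Bool => bernoulliMeasure true false p) q.2, ← h1,
      Measure.map_map (by fun_prop) (by fun_prop)]
    rfl
  · exact (hY.indep.comp (fun s b => b == s.1.1) fun _ => .of_discrete).precomp hinj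
  · exact (iIndepFun_uncurry_infinitePi' (X := fun _ _ b => b)
      (fun (_ : ℕ) (_ : Bool) => bernoulliMeasure true false p)
      (fun _ _ => measurable_id)).precomp hinj'

theorem integral_abs_correctCount_sub (hY : IsUnbiasedModel p Y P) {g h : Bool × Bool}
    (hgh : g ≠ h) :
    ∫ ω, |(correctCount (fun s => Y s ω) g : ℝ) - correctCount (fun s => Y s ω) h| ∂P =
      meanAbsBinomialDiff p N := by
  have hF : Measurable fun u : Fin N × Bool → Bool =>
      |∑ i : Fin N, indicatorDiff fun b => u (i, b)| := .of_discrete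
  have := ((hY.identDistrib_correct hgh).comp hF).integral_eq
  simp only [Function.comp_def] at this
  rw [meanAbsBinomialDiff]
  simp_rw [← Fin.sum_univ_eq_sum_range]
  refine Eq.trans (integral_congr_ae (ae_of_all _ fun ω => ?_)) this
  simp only [correctCount, indicatorDiff, Finset.sum_sub_distrib, Finset.card_filter,
    Nat.cast_sum]
  congr 3 <;>
  · ext i
    simp [Bool.toNat, Bool.cond_eq_ite]

theorem integrable_comp (hY : IsUnbiasedModel p Y P) (F : (Sample N → Bool) → ℝ) :
    Integrable (fun ω => F fun s => Y s ω) P := by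
  have hm : Measurable fun ω s => Y s ω := measurable_pi_lambda _ hY.measurable
  have := Measure.isProbabilityMeasure_map (μ := P) hm.aemeasurable
  exact (Integrable.of_finite (f := F)).comp_measurable hm

theorem integral_measuredCE (hY : IsUnbiasedModel p Y P) :
    ∫ ω, measuredCE (fun s => Y s ω) ∂P = 100 / N * meanAbsBinomialDiff p N := by
  have hacc (y : Sample N → Bool) (g h : Bool × Bool) :
      |groupAccuracy y g - groupAccuracy y h| =
        100 / N * |(correctCount y g : ℝ) - correctCount y h| := by
    rw [groupAccuracy, groupAccuracy, ← sub_div, ← mul_sub, mul_div_right_comm, abs_mul,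
      abs_of_nonneg (by positivity)]
  have hi (g h : Bool × Bool) := hY.integrable_comp fun y =>
    |groupAccuracy y g - groupAccuracy y h|
  have hE {g h : Bool × Bool} (hgh : g ≠ h) :
      ∫ ω, |groupAccuracy (fun s => Y s ω) g - groupAccuracy (fun s => Y s ω) h| ∂P =
        100 / N * meanAbsBinomialDiff p N := by
    simp_rw [hacc]
    rw [integral_const_mul, hY.integral_abs_correctCount_sub hgh]
  simp only [measuredCE, contentEffect, intraEffect, interEffect]
  rw [integral_div, integral_add, integral_div, integral_div, integral_add (hi _ _) (hi _ _),
    integral_add (hi _ _) (hi _ _), hE (by simp), hE (by simp), hE (by simp), hE (by simp)]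
  · ring
  · exact ((hi _ _).add (hi _ _)).div_const 2
  · exact ((hi _ _).add (hi _ _)).div_const 2

end IsUnbiasedModel

theorem proposition1 (a : ℝ) (ha : a ∈ Set.Icc (0 : ℝ) 1)
    (Ω : ℕ → Type*) [∀ N, MeasurableSpace (Ω N)]
    (P : ∀ N, Measure (Ω N)) [∀ N, IsProbabilityMeasure (P N)]
    (Y : ∀ N, Sample N → Ω N → Bool)
    (hY : ∀ N, IsUnbiasedModel a (Y N) (P N)) :
    (∀ N, Integrable (fun ω => measuredCE (fun s => Y N s ω)) (P N)) ∧
    Tendsto (fun N : ℕ => √(N : ℝ) * ∫ ω, measuredCE (fun s => Y N s ω) ∂(P N)) atTop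
      (𝓝 (200 * √(a * (1 - a) / Real.pi))) ∧
    (fun N : ℕ => ∫ ω, measuredCE (fun s => Y N s ω) ∂(P N)) ~[atTop]
      (fun N : ℕ => 200 * √(a * (1 - a) / (Real.pi * (N : ℝ)))) := by
  obtain ⟨p, rfl⟩ : ∃ p : unitInterval, (p : ℝ) = a := ⟨⟨a, ha⟩, rfl⟩
  have hlim : Tendsto (fun N : ℕ => √(N : ℝ) * ∫ ω, measuredCE (fun s => Y N s ω) ∂(P N)) atTop
      (𝓝 (200 * √(p * (1 - p) / Real.pi))) := by
    have h := (tendsto_meanAbsBinomialDiff p).const_mul 100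
    rw [← mul_assoc, show (100 : ℝ) * 2 = 200 by norm_num] at h
    refine h.congr fun N => ?_
    rw [(hY N).integral_measuredCE]
    have : √(N : ℝ) / N = (√(N : ℝ))⁻¹ := Real.sqrt_div_self
    rw [← this]; ring
  refine ⟨fun N => (hY N).integrable_comp measuredCE, hlim, ?_⟩
  -- Equivalence to zero means eventual equality to zero, which a vanishing limit does not give; in
  -- the degenerate case both sides are identically zero.
  rcases eq_or_ne ((p : ℝ) * (1 - p)) 0 with hp | hp
  · simp [(hY _).integral_measuredCE, meanAbsBinomialDiff_eq_zero hp, hp, IsEquivalent.refl]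
  · have hpos : 0 < (p : ℝ) * (1 - p) :=
      lt_of_le_of_ne (mul_nonneg p.2.1 (sub_nonneg.2 p.2.2)) hp.symm
    have hL : 200 * √((p : ℝ) * (1 - p) / Real.pi) ≠ 0 := by positivity
    have h := ((isEquivalent_const_iff_tendsto hL).2 hlim).mul
      (IsEquivalent.refl (u := fun N : ℕ => (√(N : ℝ))⁻¹))
    refine (h.congr_left ?_).congr_right ?_
    · filter_upwards [eventually_gt_atTop 0] with N hN
      have : √(N : ℝ) ≠ 0 := by positivity
      simp only [Pi.mul_apply]
      field_simp
    · refine Eventually.of_forall fun N => ?_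
      simp only [Pi.mul_apply, Function.const_apply]
      rw [← div_div, Real.sqrt_div' _ N.cast_nonneg]
      ring
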